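/- A \emph{plane map} $G$ consists of finitely many distinct points of the plane $\mathbb{R}^2$ (vertices) and finitely many edges. Each edge is a continuous arc joining two vertices (or, for a loop, a simple closed curve through one vertex) that passes through no other vertex, and distinct edges meet at most in common end vertices. Loops and parallel edges are allowed, and $G$ need not be connected. The \emph{faces} of $G$ are the connected components of the complement in $\mathbb{R}^2$ of the union of its vertices and edges, and two faces \emph{share an edge} if some edge is contained in the boundary of both. The map $G$ is \emph{outerplanar} if every vertex lies on the boundary of the outer (unbounded) face. A sequence is \emph{non-repetitive} if it contains no two identical adjacent non-empty blocks. A colouring of the faces of $G$ is \emph{non-repetitive} if, for every finite sequence of distinct faces in which each consecutive pair of faces shares an edge, the sequence of their colours is non-repetitive. \textbf{Theorem.} If $G$ is an outerplanar map, then the faces of $G$ (including the outer face) can be non-repetitively coloured using at most five colours. -/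

import Mathlib

/-- A sequence is non-repetitive if it contains no two identical adjacent (non-empty) blocks. -/
def NonrepetitiveSeq {α : Type*} (w : List α) : Prop :=
  ∀ u : List α, u ≠ [] → ¬ (u ++ u) <:+: w

/-- A map drawn in the plane `ℂ = ℝ²`, with vertex set `V` and edge set `E`: the vertices are
distinct points, every edge is an arc joining its two ends (a simple closed curve if the ends
coincide), edges do not pass through vertices, and distinct edges meet at most in common ends.
Loops and parallel edges are allowed, and connectedness is not required. -/
structure PlaneMap (V E : Type*) where
  /-- the point of the plane at which a vertex is drawn -/
  pos : V → ℂ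
  /-- one end of an edge; the order of the two ends carries no meaning -/
  fst : E → V
  /-- the other end of an edge -/
  snd : E → V
  /-- the continuous curve along which an edge is drawn -/
  arc : (e : E) → Path (pos (fst e)) (pos (snd e))
  pos_injective : Function.Injective pos
  arc_injOn : ∀ e, Set.InjOn (arc e) (Set.Ioo 0 1)
  arc_ne_pos : ∀ e, ∀ t ∈ Set.Ioo (0 : unitInterval) 1, ∀ v, arc e t ≠ pos v
  arc_disjoint : ∀ e f, e ≠ f → Disjoint (arc e '' Set.Ioo 0 1) (arc f '' Set.Ioo 0 1)

namespace PlaneMap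

variable {V E : Type*}

/-- The set of points of the plane covered by the vertices and edges. -/
def support (G : PlaneMap V E) : Set ℂ :=
  Set.range G.pos ∪ ⋃ e, Set.range (G.arc e)

/-- The faces are the connected components of the complement of the drawing. -/
def IsFace (G : PlaneMap V E) (F : Set ℂ) : Prop :=
  ∃ z ∈ G.supportᶜ, F = connectedComponentIn G.supportᶜ z

/-- The type of faces, the outer face included. -/
abbrev Face (G : PlaneMap V E) : Type := {F : Set ℂ // G.IsFace F}

/-- Two faces share an edge if some edge lies on the boundary of both. -/
def ShareEdge (G : PlaneMap V E) (F F' : G.Face) : Prop :=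
  ∃ e, Set.range (G.arc e) ⊆ frontier F.1 ∩ frontier F'.1

/-- The map is outerplanar if every vertex lies on the boundary of the outer (unbounded) face. -/
def IsOuterplanar (G : PlaneMap V E) : Prop :=
  ∃ F, G.IsFace F ∧ ¬ Bornology.IsBounded F ∧ ∀ v, G.pos v ∈ frontier F

/-- A colouring of the faces is non-repetitive if the colours along every sequence of distinct
faces in which consecutive faces share an edge form a non-repetitive sequence. -/
def IsNonrepetitive (G : PlaneMap V E) {C : Type*} (c : G.Face → C) : Prop :=
  ∀ l : List G.Face, l.Nodup → l.IsChain G.ShareEdge → NonrepetitiveSeq (l.map c)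

end PlaneMap

/-!
Let `O` be a face whose boundary contains all vertices. If an edge `e` lies on the boundary of two
other faces `F` and `F'`, then `e` together with `O` separates `F` from `F'`: otherwise, since the
rest of the drawing together with `O` does not separate them and the two sets meet only in `O` and
limit points of `O`, Janiszewski's theorem would join `F` to `F'` in the complement of the drawing.
Hence every edge of the dual graph without `O` is a bridge, and this graph is a forest. A path in a
tree goes towards a root and then away from it, so the tree is coloured non-repetitively by writing
along the distance from the root a square-free word without palindromes of length three. Inserting
a fourth letter after every two letters of a ternary square-free word, which comes from the
Thue–Morse word, yields such a word. The face `O` gets the fifth colour.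
-/

/-- An infinite word is square-free if it contains no two identical adjacent non-empty blocks. This
is the analogue of `NonrepetitiveSeq` for infinite words. -/
def IsSquareFreeWord {α : Type*} (a : ℕ → α) : Prop :=
  ∀ i p, 0 < p → ∃ k < p, a (i + k) ≠ a (i + k + p)

/-- An infinite word is overlap-free if no square in it is followed by the first letter of that
square; it is a weakening of square-freeness that two letters can achieve. -/
def IsOverlapFreeWord {α : Type*} (a : ℕ → α) : Prop :=
  ∀ i p, 0 < p → ∃ k ≤ p, a (i + k) ≠ a (i + k + p)

/-- The Thue–Morse word: the parity of the number of ones in the binary expansion. -/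
def thueMorse (n : ℕ) : Bool :=
  (Nat.digits 2 n).sum.bodd

theorem thueMorse_eq_xor (n : ℕ) :
    thueMorse n = (decide (n % 2 = 1) ^^ thueMorse (n / 2)) := by
  rcases n.eq_zero_or_pos with rfl | hn
  · rfl
  · have hdigit : (n % 2).bodd = decide (n % 2 = 1) := by
      rcases Nat.mod_two_eq_zero_or_one n with h | h <;> rw [h] <;> rfl
    rw [thueMorse, Nat.digits_def' one_lt_two hn, List.sum_cons, Nat.bodd_add, hdigit, thueMorse]

theorem thueMorse_eq_iff_of_mod_two_eq {m n : ℕ} (h : m % 2 = n % 2) :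
    thueMorse m = thueMorse n ↔ thueMorse (m / 2) = thueMorse (n / 2) := by
  rw [thueMorse_eq_xor m, thueMorse_eq_xor n, h, Bool.xor_right_inj]

theorem thueMorse_succ_of_even {n : ℕ} (h : n % 2 = 0) : thueMorse (n + 1) = !thueMorse n := by
  rw [thueMorse_eq_xor (n + 1), thueMorse_eq_xor n, show (n + 1) % 2 = 1 by omega, h,
    show (n + 1) / 2 = n / 2 by omega]
  simp

theorem eq_xor_of_alternating {a : ℕ → Bool} {i p : ℕ}
    (h : ∀ k < p, a (i + k + 1) = !a (i + k)) : a (i + p) = (p.bodd ^^ a i) := by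
  induction p with
  | zero => simp
  | succ p ih =>
    rw [← add_assoc, h p p.lt_succ_self, ih fun k hk => h k (hk.trans p.lt_succ_self),
      Nat.bodd_succ, Bool.not_xor]

theorem isOverlapFreeWord_thueMorse : IsOverlapFreeWord thueMorse := by
  intro i p hp
  induction p using Nat.strong_induction_on generalizing i with
  | _ p ih =>
    by_contra! hoverlap
    rcases Nat.mod_two_eq_zero_or_one p with heven | hodd
    · -- halving all positions turns an overlap of even period into one of half the period
      obtain ⟨k, hk, hne⟩ := ih (p / 2) (by omega) (i / 2) (by omega)
      have := (thueMorse_eq_iff_of_mod_two_eq (by omega)).1 (hoverlap (2 * k) (by omega))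
      rw [show (i + 2 * k) / 2 = i / 2 + k by omega,
        show (i + 2 * k + p) / 2 = i / 2 + k + p / 2 by omega] at this
      exact hne this
    · -- one of `i + k` and `i + k + p` is even, so the letter changes after both
      have alternating : ∀ k < p, thueMorse (i + k + 1) = !thueMorse (i + k) := by
        intro k hk
        rcases Nat.mod_two_eq_zero_or_one (i + k) with h | h
        · exact thueMorse_succ_of_even h
        · rw [add_assoc, hoverlap (k + 1) hk, hoverlap k hk.le,
            ← thueMorse_succ_of_even (by omega)]
          ring_nf
      have hp_bodd : p.bodd = true := by rw [Nat.mod_two_of_bodd] at hodd; simpa using hodd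
      have hstart : thueMorse i = thueMorse (i + p) := hoverlap 0 p.zero_le
      rw [eq_xor_of_alternating alternating, hp_bodd] at hstart
      simp at hstart

theorem IsOverlapFreeWord.isSquareFreeWord_compare {t : ℕ → Bool} (ht : IsOverlapFreeWord t) :
    IsSquareFreeWord fun n => compare (t n) (t (n + 1)) := by
  intro i p hp
  by_contra! hsquare
  have eq_succ : ∀ {b b' c c' : Bool}, compare b b' = compare c c' → b = c → b' = c' := by decide
  have eq_of_ne : ∀ {b b' c c' : Bool}, compare b b' = compare c c' → b ≠ c →
      b' = b ∧ c' = c := by decide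
  have hstart : t i = t (i + p) := by
    by_contra hne
    have hconst : ∀ k ≤ p, t (i + k) = t i ∧ t (i + k + p) = t (i + p) := by
      intro k hk
      induction k with
      | zero => simp
      | succ k ih =>
        obtain ⟨h, h'⟩ := ih (by omega)
        have := eq_of_ne (hsquare k hk) (by rwa [h, h'])
        rw [h, h'] at this
        rwa [← add_assoc, add_right_comm _ 1 p]
    exact hne (hconst p le_rfl).1.symm
  obtain ⟨k, hk, hne⟩ := ht i p hp
  refine hne ?_
  clear hne
  induction k with
  | zero => exact hstart
  | succ k ih =>
    rw [← add_assoc, add_right_comm _ 1 p]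
    exact eq_succ (hsquare k hk) (ih (by omega))

/-- The word obtained from `s` by inserting a new letter `none` after every two letters. -/
def insertEveryThird {α : Type*} (s : ℕ → α) (n : ℕ) : Option α :=
  if n % 3 = 2 then none else some (s (n - n / 3))

theorem IsSquareFreeWord.ne_succ {α : Type*} {a : ℕ → α} (ha : IsSquareFreeWord a) (n : ℕ) :
    a n ≠ a (n + 1) := by
  simpa using ha n 1 one_pos

section insertEveryThird

variable {α : Type*} {s : ℕ → α}

theorem insertEveryThird_eq_iff {m n : ℕ} : insertEveryThird s m = insertEveryThird s n ↔
    (m % 3 = 2 ∧ n % 3 = 2) ∨ (m % 3 ≠ 2 ∧ n % 3 ≠ 2 ∧ s (m - m / 3) = s (n - n / 3)) := by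
  unfold insertEveryThird
  split_ifs <;> simp_all

theorem IsSquareFreeWord.insertEveryThird_ne_succ (hs : IsSquareFreeWord s) (n : ℕ) :
    insertEveryThird s n ≠ insertEveryThird s (n + 1) := by
  rw [Ne, insertEveryThird_eq_iff]
  rintro (h | ⟨h, h', hletter⟩)
  · omega
  · rw [show n + 1 - (n + 1) / 3 = n - n / 3 + 1 by omega] at hletter
    exact hs.ne_succ _ hletter

theorem IsSquareFreeWord.insertEveryThird_ne_add_two (hs : IsSquareFreeWord s) (n : ℕ) :
    insertEveryThird s n ≠ insertEveryThird s (n + 2) := by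
  rw [Ne, insertEveryThird_eq_iff]
  rintro (h | ⟨-, h', hletter⟩)
  · omega
  · rw [show n + 2 - (n + 2) / 3 = n - n / 3 + 1 by omega] at hletter
    exact hs.ne_succ _ hletter

theorem IsSquareFreeWord.insertEveryThird (hs : IsSquareFreeWord s) :
    IsSquareFreeWord (insertEveryThird s) := by
  intro i p hp
  by_contra! hsquare
  have hp3 : 3 ≤ p := by
    by_contra! h
    obtain rfl | rfl : p = 1 ∨ p = 2 := by omega
    · exact hs.insertEveryThird_ne_succ i (hsquare 0 hp)
    · exact hs.insertEveryThird_ne_add_two i (hsquare 0 hp)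
  have hdvd : p % 3 = 0 := by
    -- the first position from `i` on that holds a `none`
    have := insertEveryThird_eq_iff.1 (hsquare ((5 - i % 3) % 3) (by omega))
    omega
  obtain ⟨k, hk, hne⟩ := hs (i - i / 3) (p - p / 3) (by omega)
  -- the letter `s m` stands at position `m + m / 2`
  obtain ⟨n, hn⟩ : ∃ n, n = (i - i / 3 + k) + (i - i / 3 + k) / 2 := ⟨_, rfl⟩
  have := insertEveryThird_eq_iff.1 (hsquare (n - i) (by omega))
  rw [show i + (n - i) = n by omega, show n - n / 3 = i - i / 3 + k by omega,
    show n + p - (n + p) / 3 = i - i / 3 + k + (p - p / 3) by omega] at this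
  rcases this with h | h
  · omega
  · exact hne h.2.2

end insertEveryThird

theorem IsSquareFreeWord.comp_injective {α β : Type*} {a : ℕ → α} (ha : IsSquareFreeWord a)
    {f : α → β} (hf : Function.Injective f) : IsSquareFreeWord (f ∘ a) := fun i p hp =>
  (ha i p hp).imp fun _ h => ⟨h.1, hf.ne h.2⟩

theorem IsSquareFreeWord.const_add {α : Type*} {a : ℕ → α} (ha : IsSquareFreeWord a) (d : ℕ) :
    IsSquareFreeWord fun n => a (d + n) := fun i p hp => by
  simpa only [add_assoc] using ha (d + i) p hp

theorem exists_isSquareFreeWord_fin_four :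
    ∃ a : ℕ → Fin 4, IsSquareFreeWord a ∧ ∀ n, a n ≠ a (n + 2) := by
  have hs := isOverlapFreeWord_thueMorse.isSquareFreeWord_compare
  have e : Option Ordering ≃ Fin 4 := Fintype.equivOfCardEq rfl
  exact ⟨_, hs.insertEveryThird.comp_injective e.injective,
    fun n => e.injective.ne (hs.insertEveryThird_ne_add_two n)⟩

theorem IsSquareFreeWord.exists_natAbs_ne {α : Type*} {a : ℕ → α} (ha : IsSquareFreeWord a)
    (hpal : ∀ n, a n ≠ a (n + 2)) (i : ℤ) {p : ℕ} (hp : 0 < p) :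
    ∃ k < p, a (i + k).natAbs ≠ a (i + k + p).natAbs := by
  wlog hmid : 0 < i + p generalizing i
  · obtain ⟨k, hk, hne⟩ := this (1 - (i + 2 * p)) (by omega)
    refine ⟨p - 1 - k, by omega, fun h => hne ?_⟩
    convert! h.symm using 2 <;> omega
  by_contra! hsquare
  rcases le_or_gt 0 i with hi | hi
  · obtain ⟨k, hk, hne⟩ := ha i.toNat p hp
    apply hne
    convert! hsquare k hk using 2 <;> omega
  by_cases hturn : 2 ≤ i + p
  · -- the first block contains the palindrome of length three around the turning point
    have hleft := hsquare (-i - 1).toNat (by omega)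
    have hright := hsquare (-i + 1).toNat (by omega)
    apply hpal (p - 1)
    rw [show (i + (-i - 1).toNat).natAbs = (i + (-i + 1).toNat).natAbs by omega, hright] at hleft
    convert! hleft.symm using 2 <;> omega
  · -- the word is read as `p - 1, …, 1, 0` and then `1, …, p`: compare the middles
    have hi : i = 1 - p := by omega
    rcases Nat.mod_two_eq_zero_or_one p with h | h
    · apply hpal (p / 2 - 1)
      convert! hsquare (p / 2) (by omega) using 2 <;> omega
    · apply ha.ne_succ (p / 2)
      convert! hsquare (p / 2) (by omega) using 2 <;> omega

/-- A vertex colouring of a graph is non-repetitive if no path carries a repetitive sequence of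
colours. -/
def IsNonrepetitiveColoring {α C : Type*} (H : SimpleGraph α) (c : α → C) : Prop :=
  ∀ l : List α, l.Nodup → l.IsChain H.Adj → NonrepetitiveSeq (l.map c)

section Coloring

variable {α C : Type*} {H : SimpleGraph α}

theorem isNonrepetitiveColoring_iff {c : α → C} : IsNonrepetitiveColoring H c ↔
    ∀ x y : List α, (x ++ y).Nodup → (x ++ y).IsChain H.Adj → x.map c = y.map c → x = [] := by
  constructor
  · intro h x y hnodup hchain hxy
    by_contra hx
    exact h _ hnodup hchain (x.map c) (by simpa using hx) (by rw [List.map_append, hxy])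
  · rintro h l hnodup hchain u hu hsquare
    obtain ⟨l', hl', hl'u⟩ := List.infix_map_iff.1 hsquare
    obtain ⟨x, y, rfl, rfl, hxy⟩ := List.append_eq_map_iff.1 hl'u
    exact hu (by rw [h x y (hnodup.sublist hl'.sublist) (hchain.infix hl') hxy.symm, List.map_nil])

theorem IsNonrepetitiveColoring.comp_injective {D : Type*} {c : α → C}
    (hc : IsNonrepetitiveColoring H c) {f : C → D} (hf : Function.Injective f) :
    IsNonrepetitiveColoring H (f ∘ c) := by
  rw [isNonrepetitiveColoring_iff] at hc ⊢
  intro x y hnodup hchain hxy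
  rw [← List.map_map, ← List.map_map] at hxy
  exact hc x y hnodup hchain (hf.list_map hxy)

open Classical in
/-- The extension to the whole graph of a colouring of the complement of a vertex `v`, which gives
`v` a new colour. -/
noncomputable def extendColoring {v : α} (c : ({v}ᶜ : Set α) → C) (x : α) : Option C :=
  if h : x = v then none else some (c ⟨x, h⟩)

theorem isNonrepetitiveColoring_extendColoring {v : α} {c : ({v}ᶜ : Set α) → C}
    (hc : IsNonrepetitiveColoring (H.induce {v}ᶜ) c) :
    IsNonrepetitiveColoring H (extendColoring c) := by
  rw [isNonrepetitiveColoring_iff] at hc ⊢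
  intro x y hnodup hchain hxy
  have hmem : v ∈ x ↔ v ∈ y := by
    have hnone : ∀ l : List α, none ∈ l.map (extendColoring c) ↔ v ∈ l := by
      simp [extendColoring]
    rw [← hnone, hxy, hnone]
  have hvx : v ∉ x := fun h => List.disjoint_of_nodup_append hnodup h (hmem.1 h)
  lift x to List ({v}ᶜ : Set α) using fun w hw h => hvx (h ▸ hw)
  lift y to List ({v}ᶜ : Set α) using fun w hw h => hvx (hmem.2 (h ▸ hw))
  rw [List.map_map, List.map_map, (_ : extendColoring c ∘ Subtype.val = some ∘ c),
    ← List.map_map, ← List.map_map] at hxy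
  · rw [← List.map_append] at hnodup hchain
    rw [hc x y hnodup.of_map (by rwa [List.isChain_map] at hchain)
      ((Option.some_injective C).list_map hxy), List.map_nil]
  · funext w
    exact dif_neg w.2

theorem eq_of_adj_of_dist_lt (hT : H.IsAcyclic) {r x y z : α} (hr : H.Reachable r y)
    (hx : H.Adj x y) (hz : H.Adj z y) (hxy : H.dist r x < H.dist r y)
    (hzy : H.dist r z < H.dist r y) : x = z := by
  have ext : ∀ w, H.Adj w y → H.dist r w < H.dist r y →
      ∃ q : H.Walk y r, q.IsPath ∧ q.snd = w := by
    intro w hw hlt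
    obtain ⟨q, hq, hlen⟩ := (hw.reachable.trans hr.symm).exists_path_of_dist
    refine ⟨.cons hw.symm q, hq.cons fun hmem => ?_, by simp⟩
    classical
    have h1 := H.dist_le (q.dropUntil y hmem)
    have h2 := q.length_dropUntil_le_length hmem
    rw [H.dist_comm] at h1 hlen
    omega
  obtain ⟨p, hp, rfl⟩ := ext x hx hxy
  obtain ⟨q, hq, rfl⟩ := ext z hz hzy
  have hpq := (hT.subsingleton_path y r).elim ⟨p, hp⟩ ⟨q, hq⟩
  rw [Subtype.mk.injEq] at hpq
  rw [hpq]

theorem exists_dist_eq_add_natAbs (hT : H.IsAcyclic) {r : α} {l : List α} (hnodup : l.Nodup)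
    (hchain : l.IsChain H.Adj) (hr : ∀ v ∈ l, H.Reachable r v) :
    ∃ d m : ℕ, ∀ k (hk : k < l.length), H.dist r l[k] = d + (-m + k : ℤ).natAbs := by
  induction l with
  | nil => exact ⟨0, 0, by simp⟩
  | cons x l ih =>
    rcases l with _ | ⟨y, l⟩
    · exact ⟨H.dist r x, 0, by simp⟩
    obtain ⟨hadj, hchain'⟩ := List.isChain_cons_cons.1 hchain
    have hr' : ∀ v ∈ y :: l, H.Reachable r v := fun v hv => hr v (List.mem_cons_of_mem x hv)
    obtain ⟨d, m, hdist⟩ := ih hnodup.of_cons hchain' hr'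
    have hy : H.dist r y = d + m := (hdist 0 (by simp)).trans (by simp)
    rcases hT.dist_eq_dist_add_one_of_adj_of_reachable r hadj (hr x (by simp)) with h | h
    · refine ⟨d, m + 1, fun k hk => ?_⟩
      rcases k with _ | k
      · simp only [List.getElem_cons_zero]; omega
      · rw [List.getElem_cons_succ, hdist k (by simpa using hk)]; omega
    · have haway : ∀ k (hk : k < (y :: l).length), H.dist r (y :: l)[k] = H.dist r y + k := by
        rcases l with _ | ⟨z, l⟩
        · simp
        have hz : H.dist r z = d + (-m + 1 : ℤ).natAbs := hdist 1 (by simp)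
        have hm : m = 0 := by
          by_contra hm
          have hxz : x = z := eq_of_adj_of_dist_lt hT (hr' y (by simp)) hadj
            (List.isChain_cons_cons.1 hchain').1.symm (by omega) (by omega)
          simp [hxz] at hnodup
        intro k hk
        rw [hdist k hk]
        omega
      refine ⟨H.dist r x, 0, fun k hk => ?_⟩
      rcases k with _ | k
      · simp
      · rw [List.getElem_cons_succ, haway k (by simpa using hk)]; omega

theorem exists_isNonrepetitiveColoring_of_isAcyclic (hT : H.IsAcyclic) :
    ∃ c : α → Fin 4, IsNonrepetitiveColoring H c := by
  obtain ⟨a, ha, hpal⟩ := exists_isSquareFreeWord_fin_four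
  refine ⟨fun v => a (H.dist (H.connectedComponentMk v).out v),
    isNonrepetitiveColoring_iff.2 fun x y hnodup hchain hxy => ?_⟩
  by_contra hx
  obtain ⟨v, hv⟩ := List.exists_mem_of_ne_nil x hx
  have hcomponent : ∀ w ∈ x ++ y, H.connectedComponentMk w = H.connectedComponentMk v := by
    have hpairwise : ((x ++ y).map H.connectedComponentMk).Pairwise (· = ·) :=
      List.isChain_iff_pairwise.1 <| (List.isChain_map _).2 <|
        hchain.imp fun _ _ h => SimpleGraph.ConnectedComponent.sound h.reachable
    exact fun w hw => hpairwise.forall_of_forall (fun _ _ => rfl) (List.mem_map_of_mem hw)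
      (List.mem_map_of_mem (List.mem_append_left y hv))
  have hreachable : ∀ w ∈ x ++ y, H.Reachable (H.connectedComponentMk v).out w := fun w hw =>
    SimpleGraph.ConnectedComponent.exact ((Quot.out_eq _).trans (hcomponent w hw).symm)
  obtain ⟨d, m, hdist⟩ := exists_dist_eq_add_natAbs hT hnodup hchain hreachable
  have hlength : x.length = y.length := by simpa using congrArg List.length hxy
  obtain ⟨k, hk, hne⟩ := (ha.const_add d).exists_natAbs_ne (fun n => hpal (d + n)) (-m)
    (List.length_pos_iff.2 hx)
  have hcolor : ∀ k (hk : k < (x ++ y).length),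
      a (H.dist (H.connectedComponentMk (x ++ y)[k]).out (x ++ y)[k]) =
        a (d + (-m + k : ℤ).natAbs) := fun k hk => by
    rw [hcomponent _ (List.getElem_mem hk), hdist]
  have hxk := hcolor k (by simp; omega)
  have hyk := hcolor (k + x.length) (by simp; omega)
  rw [List.getElem_append_left hk] at hxk
  rw [List.getElem_append_right (by omega)] at hyk
  simp only [Nat.add_sub_cancel] at hyk
  apply hne
  rw [← hxk, add_assoc, ← Nat.cast_add, ← hyk]
  simpa [hk, hlength ▸ hk] using congrArg (·[k]?) hxy

end Coloring

open Set Metric Topology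

/-- The function `f` has a continuous logarithm on the set `s`. A compact plane set does not
separate `a` from `b` exactly if `(z - a) / (z - b)` has a continuous logarithm on it. -/
def HasContinuousLogOn {X : Type*} [TopologicalSpace X] (f : X → ℂ) (s : Set X) : Prop :=
  ∃ g : X → ℂ, ContinuousOn g s ∧ ∀ z ∈ s, Complex.exp (g z) = f z

namespace HasContinuousLogOn

variable {X : Type*} [TopologicalSpace X] {f f' : X → ℂ} {s : Set X}

theorem mono {t : Set X} (h : HasContinuousLogOn f s) (hts : t ⊆ s) : HasContinuousLogOn f t :=
  h.imp fun _ hg => ⟨hg.1.mono hts, fun z hz => hg.2 z (hts hz)⟩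

theorem congr (h : HasContinuousLogOn f s) (hff' : EqOn f f' s) : HasContinuousLogOn f' s :=
  h.imp fun _ hg => ⟨hg.1, fun z hz => (hg.2 z hz).trans (hff' hz)⟩

theorem inv (h : HasContinuousLogOn f s) : HasContinuousLogOn (fun z => (f z)⁻¹) s :=
  let ⟨g, hg, hgf⟩ := h
  ⟨fun z => -g z, hg.neg, fun z hz => by rw [Complex.exp_neg, hgf z hz]⟩

end HasContinuousLogOn

theorem hasContinuousLogOn_iff_exists_continuousMap {X : Type*} [TopologicalSpace X] {f : X → ℂ}
    {s : Set X} : HasContinuousLogOn f s ↔ ∃ g : C(s, ℂ), ∀ z, Complex.exp (g z) = f z := by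
  classical
  constructor
  · rintro ⟨g, hg, hgf⟩
    exact ⟨⟨s.domRestrict g, continuousOn_iff_continuous_domRestrict.1 hg⟩, fun z => hgf z z.2⟩
  · rintro ⟨g, hgf⟩
    refine ⟨fun z => if hz : z ∈ s then g ⟨z, hz⟩ else 0, ?_, fun z hz => ?_⟩
    · rw [continuousOn_iff_continuous_domRestrict]
      exact g.continuous.congr fun z => by simp
    · simp only [dif_pos hz, hgf]

theorem exists_exp_eq_of_homotopy {X : Type*} [TopologicalSpace X] {H : unitInterval × X → ℂ}
    (hH : Continuous H) (hH0 : ∀ x, H x ≠ 0) (hH1 : ∀ x, H (0, x) = 1) :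
    ∃ g : C(unitInterval × X, ℂ), ∀ x, Complex.exp (g x) = H x := by
  let H' : C(unitInterval × X, {z : ℂ // z ≠ 0}) := ⟨fun x => ⟨H x, hH0 x⟩, hH.subtype_mk hH0⟩
  have hH' : ∀ x, H' (0, x) = ⟨_, Complex.exp_ne_zero ((0 : C(X, ℂ)) x)⟩ := fun x =>
    Subtype.ext ((hH1 x).trans Complex.exp_zero.symm)
  exact ⟨Complex.isCoveringMap_exp.liftHomotopy H' 0 hH', fun x =>
    congrArg Subtype.val (congrFun (Complex.isCoveringMap_exp.liftHomotopy_lifts H' 0 hH') x)⟩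

theorem hasContinuousLogOn_of_joinedIn_compl {K : Set ℂ} {a b : ℂ} (h : JoinedIn Kᶜ a b) :
    HasContinuousLogOn (fun z => (z - a) / (z - b)) K := by
  obtain ⟨γ, hγ⟩ := h.symm
  have hne : ∀ (z : K) t, (z : ℂ) - γ t ≠ 0 := fun z t h0 => hγ t (sub_eq_zero.1 h0 ▸ z.2)
  have hneb : ∀ z : K, (z : ℂ) - b ≠ 0 := fun z => by simpa using hne z 0
  have hcont : Continuous fun x : unitInterval × K => ((x.2 : ℂ) - γ x.1) / (x.2 - b) :=
    Continuous.div (by fun_prop) (by fun_prop) fun x => hneb x.2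
  obtain ⟨g, hg⟩ := exists_exp_eq_of_homotopy hcont
    (fun x => div_ne_zero (hne x.2 x.1) (hneb x.2)) fun z => by simp [hneb z]
  exact hasContinuousLogOn_iff_exists_continuousMap.2
    ⟨g.comp (.prodMk (.const K 1) (.id K)), fun z => by simp [hg]⟩

theorem sub_eq_sub_of_exp_eq_exp {X : Type*} [TopologicalSpace X] {s : Set X}
    (hs : IsPreconnected s) {g h : X → ℂ} (hg : ContinuousOn g s) (hh : ContinuousOn h s)
    (heq : ∀ z ∈ s, Complex.exp (g z) = Complex.exp (h z)) {x y : X} (hx : x ∈ s) (hy : y ∈ s) :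
    g x - h x = g y - h y := by
  refine hs.constant_of_mapsTo (f := fun z => g z - h z)
    (T := (AddSubgroup.zmultiples (2 * Real.pi * Complex.I) : Set ℂ)) ?_ (hg.sub hh) ?_ hx hy
  · rw [isDiscrete_iff_discreteTopology]
    exact NormedSpace.discreteTopology_zmultiples _
  · intro z hz
    obtain ⟨n, hn⟩ := Complex.exp_eq_exp_iff_exists_int.1 (heq z hz)
    exact ⟨n, by simp [hn]⟩

theorem exists_eq_add_of_exp_eq_exp {X : Type*} [TopologicalSpace X] {s : Set X}
    (hs : IsPreconnected s) {g h : X → ℂ} (hg : ContinuousOn g s) (hh : ContinuousOn h s)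
    (heq : ∀ z ∈ s, Complex.exp (g z) = Complex.exp (h z)) :
    ∃ c, Complex.exp c = 1 ∧ ∀ z ∈ s, g z = h z + c := by
  rcases s.eq_empty_or_nonempty with rfl | ⟨p, hp⟩
  · exact ⟨0, Complex.exp_zero, by simp⟩
  · refine ⟨g p - h p, ?_, fun z hz => ?_⟩
    · rw [Complex.exp_sub, heq p hp, div_self (Complex.exp_ne_zero _)]
    · rw [← sub_eq_sub_of_exp_eq_exp hs hg hh heq hz hp, add_sub_cancel]

theorem HasContinuousLogOn.union {X : Type*} [TopologicalSpace X] {f : X → ℂ} {A B C : Set X}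
    (hA : IsClosed A) (hB : IsClosed B) (hC : IsPreconnected C) (hAB : A ∩ B ⊆ C)
    (hfA : HasContinuousLogOn f (A ∪ C)) (hfB : HasContinuousLogOn f (B ∪ C)) :
    HasContinuousLogOn f (A ∪ B) := by
  classical
  obtain ⟨g, hg, hgf⟩ := hfA
  obtain ⟨h, hh, hhf⟩ := hfB
  obtain ⟨c, hc, hgh⟩ := exists_eq_add_of_exp_eq_exp hC (hg.mono subset_union_right)
    (hh.mono subset_union_right) fun z hz => (hgf z (Or.inr hz)).trans (hhf z (Or.inr hz)).symm
  have heqB : EqOn (A.piecewise g (fun z => h z + c)) (fun z => h z + c) B := by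
    intro z hz
    by_cases hzA : z ∈ A
    · rw [piecewise_eq_of_mem _ _ _ hzA, hgh z (hAB ⟨hzA, hz⟩)]
    · rw [piecewise_eq_of_notMem _ _ _ hzA]
  refine ⟨A.piecewise g (fun z => h z + c), ContinuousOn.union_of_isClosed ?_ ?_ hA hB, ?_⟩
  · exact (hg.mono subset_union_left).congr (piecewise_eqOn _ _ _)
  · exact ((hh.mono subset_union_left).add continuousOn_const).congr heqB
  · rintro z (hz | hz)
    · rw [piecewise_eq_of_mem _ _ _ hz, hgf z (Or.inl hz)]
    · rw [heqB hz, Complex.exp_add, hc, mul_one, hhf z (Or.inl hz)]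

theorem hasContinuousLogOn_univ {X : Type*} [TopologicalSpace X] [SimplyConnectedSpace X]
    [LocallyPathConnectedSpace X] {f : X → ℂ} (hf : Continuous f) (h0 : ∀ z, f z ≠ 0) :
    HasContinuousLogOn f univ := by
  obtain ⟨x⟩ : Nonempty X := inferInstance
  obtain ⟨g, ⟨-, hg⟩, -⟩ := Complex.isCoveringMapOn_exp.existsUnique_continuousMap_lifts
    ⟨f, hf⟩ (a₀ := x) (Complex.exp_log (h0 x)) h0
  exact ⟨g, g.continuous.continuousOn, fun z _ => congrFun hg z⟩

theorem not_hasContinuousLogOn_sphere (a : ℂ) {r : ℝ} (hr : 0 < r) :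
    ¬ HasContinuousLogOn (fun z => z - a) (sphere a r) := by
  rintro ⟨g, hg, hga⟩
  let circle : ℝ → ℂ := fun θ => a + r * Complex.exp (θ * Complex.I)
  have hcircle : ∀ θ, circle θ ∈ sphere a r := fun θ => by
    simp [circle, Complex.norm_exp, abs_of_pos hr]
  have hconst := sub_eq_sub_of_exp_eq_exp (isPreconnected_univ (α := ℝ)) (g := g ∘ circle)
    (h := fun θ => Complex.log r + θ * Complex.I)
    (hg.comp (by fun_prop) fun θ _ => hcircle θ) (by fun_prop)
    (fun θ _ => by
      rw [Function.comp_apply, hga _ (hcircle θ), Complex.exp_add,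
        Complex.exp_log (by exact_mod_cast hr.ne')]
      simp [circle]) (mem_univ 0) (mem_univ (2 * Real.pi))
  simp [circle, Complex.exp_two_pi_mul_I] at hconst

theorem frontier_connectedComponentIn_compl_subset {X : Type*} [TopologicalSpace X]
    [LocallyConnectedSpace X] {K : Set X} (hK : IsClosed K) (a : X) :
    frontier (connectedComponentIn Kᶜ a) ⊆ K := by
  intro z hz
  by_contra hzK
  obtain ⟨w, hwz, hwa⟩ := mem_closure_iff.1 hz.1 _ hK.isOpen_compl.connectedComponentIn
    (mem_connectedComponentIn hzK)
  rw [hK.isOpen_compl.connectedComponentIn.frontier_eq, connectedComponentIn_eq hwa,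
    ← connectedComponentIn_eq hwz] at hz
  exact hz.2 (mem_connectedComponentIn hzK)

/-- Otherwise, multiplying `z - b` on the component of `a` by an extension of the quotient
`(z - a) / (z - b)` without zeros yields a function without zeros that agrees with `z - a` on a
large circle. -/
theorem mem_connectedComponentIn_of_hasContinuousLogOn_of_isBounded {K : Set ℂ} (hK : IsClosed K)
    {a b : ℂ} (ha : a ∉ K) (hb : b ∉ K) (hlog : HasContinuousLogOn (fun z => (z - a) / (z - b)) K)
    (hbounded : Bornology.IsBounded (connectedComponentIn Kᶜ a)) :
    b ∈ connectedComponentIn Kᶜ a := by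
  classical
  by_contra hbU
  set U := connectedComponentIn Kᶜ a
  have haU : a ∈ U := mem_connectedComponentIn ha
  obtain ⟨r, hr⟩ := hbounded.subset_ball a
  have hr0 : 0 < r := by simpa using hr haU
  obtain ⟨g, hg⟩ := hasContinuousLogOn_iff_exists_continuousMap.1 hlog
  obtain ⟨G, rfl⟩ := ContinuousMap.exists_restrict_eq hK g
  let φ : ℂ → ℂ := fun z => if z ∈ U then (z - b) * Complex.exp (G z) else z - a
  have hφ : Continuous φ := by
    refine Continuous.if (fun z hz => ?_) (by fun_prop) (by fun_prop)
    have hzK : z ∈ K := frontier_connectedComponentIn_compl_subset hK a hz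
    rw [show Complex.exp (G z) = _ from hg ⟨z, hzK⟩, mul_div_cancel₀]
    exact sub_ne_zero.2 fun h => hb (h ▸ hzK)
  have hφ0 : ∀ z, φ z ≠ 0 := by
    intro z
    unfold φ
    split_ifs with hz
    · exact mul_ne_zero (sub_ne_zero.2 fun h => hbU (h ▸ hz)) (Complex.exp_ne_zero _)
    · exact sub_ne_zero.2 fun h => hz (h ▸ haU)
  refine not_hasContinuousLogOn_sphere a hr0
    (((hasContinuousLogOn_univ hφ hφ0).mono (subset_univ _)).congr fun z hz => if_neg fun hzU => ?_)
  exact (mem_ball.1 (hr hzU)).ne hz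

theorem isPreconnected_compl_closedBall {E : Type*} [NormedAddCommGroup E] [NormedSpace ℝ E]
    (hE : 1 < Module.rank ℝ E) {r : ℝ} (hr : 0 ≤ r) : IsPreconnected (closedBall (0 : E) r)ᶜ := by
  have : (closedBall (0 : E) r)ᶜ = (fun x : ℝ × E => x.1 • x.2) '' Ioi r ×ˢ sphere 0 1 := by
    ext z
    simp only [mem_compl_iff, mem_closedBall, dist_zero_right, not_le]
    constructor
    · intro hz
      exact ⟨(‖z‖, ‖z‖⁻¹ • z), ⟨hz, by simp [norm_smul, (hr.trans_lt hz).ne']⟩,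
        smul_inv_smul₀ (hr.trans_lt hz).ne' z⟩
    · rintro ⟨⟨t, u⟩, ⟨ht, hu⟩, rfl⟩
      rw [mem_sphere_zero_iff_norm] at hu
      simpa [norm_smul, hu] using ht.out.trans_le (le_abs_self t)
  rw [this]
  exact (isPreconnected_Ioi.prod (isPreconnected_sphere hE 0 1)).image _ (by fun_prop)

theorem isBounded_connectedComponentIn_compl_or {E : Type*} [NormedAddCommGroup E]
    [NormedSpace ℝ E] (hE : 1 < Module.rank ℝ E) {K : Set E} (hK : Bornology.IsBounded K) {a b : E}
    (hb : b ∉ connectedComponentIn Kᶜ a) :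
    Bornology.IsBounded (connectedComponentIn Kᶜ a) ∨
      Bornology.IsBounded (connectedComponentIn Kᶜ b) := by
  obtain ⟨r, hr, hKr⟩ := hK.subset_closedBall_lt 0 0
  by_contra! h
  have hmeets : ∀ {s : Set E}, ¬ Bornology.IsBounded s → ∃ z ∈ s, z ∈ (closedBall (0 : E) r)ᶜ := by
    intro s hs
    by_contra! hsr
    exact hs (isBounded_closedBall.subset fun z hz => not_not.1 (hsr z hz))
  obtain ⟨x, hxa, hx⟩ := hmeets h.1
  obtain ⟨y, hyb, hy⟩ := hmeets h.2
  have hxy := (isPreconnected_compl_closedBall hE hr.le).subset_connectedComponentIn hx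
    (compl_subset_compl.2 hKr) hy
  apply hb
  rw [connectedComponentIn_eq hxa, connectedComponentIn_eq hxy, ← connectedComponentIn_eq hyb]
  exact mem_connectedComponentIn (connectedComponentIn_nonempty_iff.1 ⟨y, hyb⟩)

theorem mem_connectedComponentIn_of_hasContinuousLogOn {K : Set ℂ} (hK : IsCompact K)
    {a b : ℂ} (ha : a ∉ K) (hb : b ∉ K)
    (hlog : HasContinuousLogOn (fun z => (z - a) / (z - b)) K) :
    b ∈ connectedComponentIn Kᶜ a := by
  by_contra h
  have hrank : 1 < Module.rank ℝ ℂ := by rw [Complex.rank_real_complex]; exact Nat.one_lt_ofNat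
  rcases isBounded_connectedComponentIn_compl_or hrank hK.isBounded h with hbdd | hbdd
  · exact h <|
      mem_connectedComponentIn_of_hasContinuousLogOn_of_isBounded hK.isClosed ha hb hlog hbdd
  · have hlog' : HasContinuousLogOn (fun z => (z - b) / (z - a)) K := by
      simpa only [inv_div] using hlog.inv
    have := mem_connectedComponentIn_of_hasContinuousLogOn_of_isBounded hK.isClosed hb ha hlog' hbdd
    exact h (connectedComponentIn_eq this ▸ mem_connectedComponentIn hb)

/-- Janiszewski's theorem is the case that `A ∩ B` is connected and `S = A ∩ B`. -/
theorem mem_connectedComponentIn_compl_union {A B S : Set ℂ} (hA : IsCompact A) (hB : IsCompact B)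
    (hS : IsPreconnected S) (hAB : A ∩ B ⊆ closure S) {a b : ℂ} (habA : JoinedIn (A ∪ S)ᶜ a b)
    (habB : JoinedIn (B ∪ S)ᶜ a b) : b ∈ connectedComponentIn (A ∪ B)ᶜ a := by
  have hC : IsPreconnected (S ∪ A ∩ B) :=
    hS.subset_closure subset_union_left (union_subset subset_closure hAB)
  have hlog : HasContinuousLogOn (fun z => (z - a) / (z - b)) (A ∪ B) := by
    refine .union hA.isClosed hB.isClosed hC subset_union_right ?_ ?_
    · refine (hasContinuousLogOn_of_joinedIn_compl habA).mono ?_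
      grind
    · refine (hasContinuousLogOn_of_joinedIn_compl habB).mono ?_
      grind
  refine mem_connectedComponentIn_of_hasContinuousLogOn (hA.union hB) ?_ ?_ hlog
  · exact fun h => h.elim (habA.source_mem ∘ Or.inl) (habB.source_mem ∘ Or.inl)
  · exact fun h => h.elim (habA.target_mem ∘ Or.inl) (habB.target_mem ∘ Or.inl)

theorem exists_mem_frontier_joinedIn {E : Type*} [NormedAddCommGroup E] [NormedSpace ℝ E]
    [ProperSpace E] {U N : Set E} (hU : IsOpen U) (hU' : IsPreconnected U) {a q : E} (ha : a ∈ U)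
    (hq : q ∈ frontier U) (hN : N ∈ 𝓝 q) : ∃ p ∈ N ∩ frontier U, JoinedIn (insert p U) a p := by
  obtain ⟨ε, hε, hεN⟩ := Metric.mem_nhds_iff.1 hN
  obtain ⟨z, hzU, hzq⟩ := Metric.mem_closure_iff.1 hq.1 (ε / 2) (half_pos hε)
  have hqU : q ∈ Uᶜ := (hU.frontier_eq ▸ hq).2
  obtain ⟨p, hpU, hp⟩ := hU.isClosed_compl.exists_infDist_eq_dist ⟨q, hqU⟩ z
  have hball : ball z (dist z p) ⊆ U := by
    simpa only [hp, compl_compl] using ball_infDist_compl_subset (x := z) (s := U)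
  have hpz : 0 < dist z p := dist_pos.2 fun h => hpU (h ▸ hzU)
  have hpN : p ∈ N := by
    have hzp : dist z p ≤ dist z q := hp ▸ infDist_le_dist_of_mem hqU
    refine hεN (mem_ball.2 ?_)
    linarith [dist_triangle_left p q z, dist_comm z q]
  have hpc : p ∈ closure U := by
    refine closure_mono hball ?_
    rw [closure_ball z hpz.ne', mem_closedBall']
  have hsegment : segment ℝ z p ⊆ insert p U := by
    intro w hw
    refine or_iff_not_imp_left.2 fun hwp => hball ?_
    rw [mem_ball']
    linarith [dist_add_dist_of_mem_segment hw, dist_pos.2 hwp]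
  have haz : JoinedIn U a z :=
    (hU.isConnected_iff_isPathConnected.1 ⟨⟨a, ha⟩, hU'⟩).joinedIn a ha z hzU
  exact ⟨p, ⟨hpN, hpc, fun h => hpU (interior_subset h)⟩,
    (haz.mono (subset_insert p U)).trans (.of_segment_subset hsegment)⟩

theorem isPathConnected_Ioo_unitInterval {s t : unitInterval} (hst : s < t) :
    IsPathConnected (Ioo s t) := by
  have : Ioo s t = projIcc (0 : ℝ) 1 zero_le_one '' Ioo (s : ℝ) t := by
    apply Subset.antisymm
    · exact fun r hr => ⟨r, hr, projIcc_val _ r⟩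
    · rintro _ ⟨r, hr, rfl⟩
      rw [projIcc_of_mem zero_le_one ⟨s.2.1.trans hr.1.le, hr.2.le.trans t.2.2⟩]
      exact hr
  rw [this]
  exact ((convex_Ioo (s : ℝ) t).isPathConnected (nonempty_Ioo.2 hst)).image continuous_projIcc

namespace PlaneMap

variable {V E : Type*} {G : PlaneMap V E} {e f : E} {r s t : unitInterval}

section Arc

theorem range_arc_subset_support (G : PlaneMap V E) (e : E) : range (G.arc e) ⊆ G.support :=
  (subset_iUnion (fun e => range (G.arc e)) e).trans subset_union_right

theorem arc_mem_range_pos_or_mem_Ioo (G : PlaneMap V E) (e : E) (r : unitInterval) :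
    G.arc e r ∈ range G.pos ∨ r ∈ Ioo (0 : unitInterval) 1 := by
  rcases (unitInterval.nonneg' (t := r)).eq_or_lt with rfl | h0
  · exact Or.inl ⟨_, (G.arc e).source.symm⟩
  rcases (unitInterval.le_one' (t := r)).eq_or_lt with rfl | h1
  · exact Or.inl ⟨_, (G.arc e).target.symm⟩
  · exact Or.inr ⟨h0, h1⟩

theorem eq_and_eq_of_arc_eq_arc (ht : t ∈ Ioo 0 1) (h : G.arc f r = G.arc e t) :
    f = e ∧ r = t := by
  rcases G.arc_mem_range_pos_or_mem_Ioo f r with ⟨v, hv⟩ | hr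
  · exact absurd (h.symm.trans hv.symm) (G.arc_ne_pos e t ht v)
  · obtain rfl : f = e := by
      by_contra hfe
      exact disjoint_left.1 (G.arc_disjoint f e hfe) ⟨r, hr, rfl⟩ ⟨t, ht, h.symm⟩
    exact ⟨rfl, G.arc_injOn f hr ht h⟩

theorem Ioo_subset_Ioo_zero_one : Ioo s t ⊆ Ioo 0 1 :=
  Ioo_subset_Ioo unitInterval.nonneg' unitInterval.le_one'

theorem arc_mem_image_Ioo_iff : G.arc f r ∈ G.arc e '' Ioo s t ↔ f = e ∧ r ∈ Ioo s t := by
  constructor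
  · rintro ⟨q, hq, h⟩
    obtain ⟨rfl, rfl⟩ := eq_and_eq_of_arc_eq_arc (Ioo_subset_Ioo_zero_one hq) h.symm
    exact ⟨rfl, hq⟩
  · rintro ⟨rfl, hr⟩
    exact mem_image_of_mem _ hr

theorem image_arc_subset_support_diff {I : Set unitInterval} (hI : f = e → Disjoint I (Ioo s t)) :
    G.arc f '' I ⊆ G.support \ G.arc e '' Ioo s t := by
  rintro _ ⟨r, hr, rfl⟩
  refine ⟨G.range_arc_subset_support f (mem_range_self r), fun h => ?_⟩
  obtain ⟨hfe, hrst⟩ := arc_mem_image_Ioo_iff.1 h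
  exact disjoint_left.1 (hI hfe) hr hrst

theorem support_diff_image_Ioo (G : PlaneMap V E) (e : E) (s t : unitInterval) :
    G.support \ G.arc e '' Ioo s t =
      range G.pos ∪ ⋃ f, G.arc f '' {r | f = e → r ∉ Ioo s t} := by
  apply Subset.antisymm
  · rintro z ⟨hz | hz, hze⟩
    · exact Or.inl hz
    · obtain ⟨f, r, rfl⟩ := mem_iUnion.1 hz
      refine Or.inr (mem_iUnion.2 ⟨f, r, fun hfe hr => hze ?_, rfl⟩)
      exact arc_mem_image_Ioo_iff.2 ⟨hfe, hr⟩
  · refine union_subset ?_ (iUnion_subset fun f => ?_)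
    · rintro _ ⟨v, rfl⟩
      exact ⟨Or.inl ⟨v, rfl⟩, fun ⟨q, hq, h⟩ => G.arc_ne_pos e q (Ioo_subset_Ioo_zero_one hq) v h⟩
    · exact image_arc_subset_support_diff fun hfe => disjoint_left.2 fun r hr => hr hfe

variable [Finite V] [Finite E]

theorem isCompact_support (G : PlaneMap V E) : IsCompact G.support :=
  (finite_range _).isCompact.union (isCompact_iUnion fun f => isCompact_range (G.arc f).continuous)

theorem isCompact_support_diff (G : PlaneMap V E) (e : E) (s t : unitInterval) :
    IsCompact (G.support \ G.arc e '' Ioo s t) := by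
  rw [support_diff_image_Ioo]
  refine (finite_range _).isCompact.union (isCompact_iUnion fun f => ?_)
  have hclosed : IsClosed {r | f = e → r ∉ Ioo s t} :=
    isClosed_imp isOpen_const isOpen_Ioo.isClosed_compl
  exact hclosed.isCompact.image (G.arc f).continuous

end Arc

namespace Face

variable {F F' O A B : G.Face} {a b : ℂ}

theorem subset_compl (F : G.Face) : F.1 ⊆ G.supportᶜ := by
  obtain ⟨_, z, -, rfl⟩ := F
  exact connectedComponentIn_subset _ _

theorem isPreconnected (F : G.Face) : IsPreconnected F.1 := by
  obtain ⟨_, z, -, rfl⟩ := F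
  exact isPreconnected_connectedComponentIn

theorem nonempty (F : G.Face) : F.1.Nonempty := by
  obtain ⟨_, z, hz, rfl⟩ := F
  exact ⟨z, mem_connectedComponentIn hz⟩

theorem eq_connectedComponentIn {a : ℂ} (ha : a ∈ F.1) :
    F.1 = connectedComponentIn G.supportᶜ a := by
  obtain ⟨z, -, hz⟩ := F.2
  rw [hz] at ha ⊢
  exact connectedComponentIn_eq ha

theorem disjoint (h : F ≠ F') : Disjoint F.1 F'.1 :=
  disjoint_left.2 fun _ ha ha' => h <|
    Subtype.ext ((eq_connectedComponentIn ha).trans (eq_connectedComponentIn ha').symm)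

variable [Finite V] [Finite E]

theorem isOpen (F : G.Face) : IsOpen F.1 := by
  obtain ⟨_, z, -, rfl⟩ := F
  exact G.isCompact_support.isClosed.isOpen_compl.connectedComponentIn

theorem frontier_subset (F : G.Face) : frontier F.1 ⊆ G.support := by
  obtain ⟨_, z, -, rfl⟩ := F
  exact frontier_connectedComponentIn_compl_subset G.isCompact_support.isClosed z

theorem joinedIn (ha : a ∈ F.1) (hb : b ∈ F.1) : JoinedIn F.1 a b :=
  (F.isOpen.isConnected_iff_isPathConnected.1 ⟨F.nonempty, F.isPreconnected⟩).joinedIn a ha b hb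

theorem exists_joinedIn_arc (he : range (G.arc e) ⊆ frontier F.1) (hst : s < t) (ha : a ∈ F.1) :
    ∃ p ∈ G.arc e '' Ioo s t, JoinedIn (F.1 ∪ G.arc e '' Ioo s t) a p := by
  obtain ⟨r, hr⟩ := exists_between hst
  have hN : (G.support \ G.arc e '' Ioo s t)ᶜ ∈ 𝓝 (G.arc e r) :=
    (G.isCompact_support_diff e s t).isClosed.isOpen_compl.mem_nhds
      fun h => h.2 (mem_image_of_mem _ hr)
  obtain ⟨p, ⟨hpN, hpF⟩, hap⟩ := exists_mem_frontier_joinedIn F.isOpen F.isPreconnected ha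
    (he (mem_range_self r)) hN
  have hp : p ∈ G.arc e '' Ioo s t := by_contra fun h => hpN ⟨F.frontier_subset hpF, h⟩
  exact ⟨p, hp, hap.mono (insert_subset (Or.inr hp) subset_union_left)⟩

theorem joinedIn_union_arc (he : range (G.arc e) ⊆ frontier F.1 ∩ frontier F'.1) (hst : s < t)
    (ha : a ∈ F.1) (hb : b ∈ F'.1) : JoinedIn (F.1 ∪ F'.1 ∪ G.arc e '' Ioo s t) a b := by
  obtain ⟨p, hp, hap⟩ := exists_joinedIn_arc (he.trans inter_subset_left) hst ha
  obtain ⟨q, hq, hbq⟩ := exists_joinedIn_arc (he.trans inter_subset_right) hst hb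
  have hpq : JoinedIn (G.arc e '' Ioo s t) p q :=
    ((isPathConnected_Ioo_unitInterval hst).image (G.arc e).continuous).joinedIn p hp q hq
  refine (hap.mono ?_).trans ((hpq.mono subset_union_right).trans (hbq.symm.mono ?_))
  · exact union_subset_union_left _ subset_union_left
  · exact union_subset_union_left _ subset_union_right

theorem joinedIn_across_arc (hFO : F ≠ O) (hFO' : F' ≠ O)
    (he : range (G.arc e) ⊆ frontier F.1 ∩ frontier F'.1) (hst : s < t) (ha : a ∈ F.1)
    (hb : b ∈ F'.1) : JoinedIn (G.support \ G.arc e '' Ioo s t ∪ O.1)ᶜ a b := by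
  refine (joinedIn_union_arc he hst ha hb).mono ?_
  have hface : ∀ {A : G.Face}, A ≠ O → A.1 ⊆ (G.support \ G.arc e '' Ioo s t ∪ O.1)ᶜ := by
    rintro A hAO z hz (h | h)
    · exact A.subset_compl hz h.1
    · exact disjoint_left.1 (disjoint hAO) hz h
  refine union_subset (union_subset (hface hFO) (hface hFO')) ?_
  rintro z hz (h | h)
  · exact h.2 hz
  · exact O.subset_compl h (G.range_arc_subset_support e (image_subset_range _ _ hz))

theorem not_joinedIn_compl_arc_union (hne : F ≠ F') (hFO : F ≠ O) (hFO' : F' ≠ O)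
    (he : range (G.arc e) ⊆ frontier F.1 ∩ frontier F'.1) (hst : s < t)
    (hs : G.arc e s ∈ closure O.1) (ht : G.arc e t ∈ closure O.1) (ha : a ∈ F.1)
    (hb : b ∈ F'.1) : ¬ JoinedIn (G.arc e '' Icc s t ∪ O.1)ᶜ a b := by
  intro hab
  have hends : (G.support \ G.arc e '' Ioo s t) ∩ G.arc e '' Icc s t ⊆ closure O.1 := by
    rintro _ ⟨⟨-, hr'⟩, r, hr, rfl⟩
    rcases eq_endpoints_or_mem_Ioo_of_mem_Icc hr with rfl | rfl | h
    · exact hs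
    · exact ht
    · exact absurd (mem_image_of_mem _ h) hr'
  have hunion : G.support \ G.arc e '' Ioo s t ∪ G.arc e '' Icc s t = G.support := by
    refine (union_subset sdiff_subset ?_).antisymm fun z hz => ?_
    · exact (image_subset_range _ _).trans (G.range_arc_subset_support e)
    · by_cases h : z ∈ G.arc e '' Ioo s t
      · exact Or.inr (image_mono Ioo_subset_Icc_self h)
      · exact Or.inl ⟨hz, h⟩
  have hbF : b ∈ connectedComponentIn G.supportᶜ a := hunion ▸
    mem_connectedComponentIn_compl_union (G.isCompact_support_diff e s t)
      (isCompact_Icc.image (G.arc e).continuous) O.isPreconnected hends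
      (joinedIn_across_arc hFO hFO' he hst ha hb) hab
  rw [← eq_connectedComponentIn ha] at hbF
  exact disjoint_left.1 (disjoint hne) hbF hb

theorem eq_or_eq_of_arc_subset_frontier (hne : F ≠ F')
    (he : range (G.arc e) ⊆ frontier F.1 ∩ frontier F'.1) (heO : range (G.arc e) ⊆ frontier O.1) :
    O = F ∨ O = F' := by
  by_contra! H
  obtain ⟨a, ha⟩ := F.nonempty
  obtain ⟨b, hb⟩ := F'.nonempty
  obtain ⟨t, h0t, ht1⟩ := exists_between (zero_lt_one (α := unitInterval))
  have hclosure : ∀ r, G.arc e r ∈ closure O.1 := fun r =>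
    frontier_subset_closure (heO (mem_range_self r))
  refine not_joinedIn_compl_arc_union hne H.1.symm H.2.symm he h0t (hclosure 0) (hclosure t) ha hb
    ((joinedIn_across_arc H.1.symm H.2.symm he ht1 ha hb).mono (compl_subset_compl.2 ?_))
  refine union_subset_union_left _ (image_arc_subset_support_diff fun _ => ?_)
  exact disjoint_left.2 fun r hr hr' => hr'.1.not_ge hr.2

theorem mk_eq_mk_of_arc_subset_frontier (hne : F ≠ F') (hne' : A ≠ B)
    (he : range (G.arc e) ⊆ frontier F.1 ∩ frontier F'.1)
    (he' : range (G.arc e) ⊆ frontier A.1 ∩ frontier B.1) : s(A, B) = s(F, F') := by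
  have hA := eq_or_eq_of_arc_subset_frontier hne he (he'.trans inter_subset_left)
  have hB := eq_or_eq_of_arc_subset_frontier hne he (he'.trans inter_subset_right)
  grind

end Face

/-- The dual graph of a plane map, without the loops and multiple edges of the dual multigraph:
the faces are its vertices, and distinct faces are adjacent if they share an edge. -/
def dualGraph (G : PlaneMap V E) : SimpleGraph G.Face where
  Adj F F' := F ≠ F' ∧ G.ShareEdge F F'
  symm := ⟨fun _ _ h => ⟨h.1.symm, h.2.imp fun _ he => he.trans (inter_comm _ _).subset⟩⟩
  loopless := ⟨fun _ h => h.1 rfl⟩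

theorem isNonrepetitive_of_dualGraph {C : Type*} {c : G.Face → C}
    (hc : IsNonrepetitiveColoring G.dualGraph c) : G.IsNonrepetitive c := by
  refine fun l hnodup hchain => hc l hnodup ?_
  refine List.isChain_iff_getElem.2 fun i hi => ⟨fun h => ?_, ?_⟩
  · exact i.lt_succ_self.ne (hnodup.getElem_inj_iff.1 h)
  · exact hchain.getElem i hi

section OuterFace

variable [Finite V] [Finite E] {O : G.Face} {F F' A B : ({O}ᶜ : Set G.Face)} {a b : ℂ}

theorem joinedIn_of_walk_deleteEdges (hne : F ≠ F')
    (he : range (G.arc e) ⊆ frontier F.1.1 ∩ frontier F'.1.1)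
    (w : ((G.dualGraph.induce {O}ᶜ).deleteEdges {s(F, F')}).Walk A B) (ha : a ∈ A.1.1)
    (hb : b ∈ B.1.1) : JoinedIn (range (G.arc e) ∪ O.1)ᶜ a b := by
  induction w generalizing a with
  | @nil A =>
    refine (Face.joinedIn ha hb).mono ?_
    rintro z hz (h | h)
    · exact A.1.subset_compl hz (G.range_arc_subset_support e h)
    · exact disjoint_left.1 (Face.disjoint A.2) hz h
  | @cons A A' B hAA' _ ih =>
    obtain ⟨⟨hneA, f, hf⟩, hdel⟩ := SimpleGraph.deleteEdges_adj.1 hAA'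
    obtain ⟨c, hc⟩ := A'.1.nonempty
    have hef : e ≠ f := by
      rintro rfl
      have := Face.mk_eq_mk_of_arc_subset_frontier (Subtype.coe_ne_coe.2 hne) hneA he hf
      exact hdel (Sym2.map.injective Subtype.val_injective this)
    refine JoinedIn.trans ?_ (ih hc hb)
    refine (Face.joinedIn_across_arc A.2 A'.2 hf zero_lt_one ha hc).mono ?_
    refine compl_subset_compl.2 (union_subset_union_left _ ?_)
    rw [← image_univ]
    exact image_arc_subset_support_diff fun h => absurd h hef

theorem isAcyclic_induce_dualGraph (hO : ∀ v, G.pos v ∈ frontier O.1) :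
    (G.dualGraph.induce {O}ᶜ).IsAcyclic := by
  rw [SimpleGraph.isAcyclic_iff_forall_adj_isBridge]
  rintro F F' ⟨hne, e, he⟩
  rw [SimpleGraph.isBridge_iff]
  rintro ⟨p⟩
  obtain ⟨a, ha⟩ := F.1.nonempty
  obtain ⟨b, hb⟩ := F'.1.nonempty
  have hs : G.arc e 0 ∈ closure O.1 := by
    simpa only [Path.source] using frontier_subset_closure (hO (G.fst e))
  have ht : G.arc e 1 ∈ closure O.1 := by
    simpa only [Path.target] using frontier_subset_closure (hO (G.snd e))
  refine Face.not_joinedIn_compl_arc_union hne F.2 F'.2 he zero_lt_one hs ht ha hb ?_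
  have := joinedIn_of_walk_deleteEdges (Subtype.coe_ne_coe.1 hne) he p ha hb
  exact this.mono (compl_subset_compl.2 (union_subset_union_left _ (image_subset_range _ _)))

end OuterFace

end PlaneMap

theorem theorem1_general {V E : Type*} [Finite V] [Finite E] (G : PlaneMap V E) (O : G.Face)
    (hO : ∀ v, G.pos v ∈ frontier O.1) : ∃ c : G.Face → Fin 5, G.IsNonrepetitive c := by
  obtain ⟨c, hc⟩ :=
    exists_isNonrepetitiveColoring_of_isAcyclic (PlaneMap.isAcyclic_induce_dualGraph hO)
  exact ⟨_, PlaneMap.isNonrepetitive_of_dualGraph <|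
    (isNonrepetitiveColoring_extendColoring hc).comp_injective finSuccEquivLast.symm.injective⟩

theorem theorem1 {V E : Type*} [Finite V] [Finite E] (G : PlaneMap V E)
    (hG : G.IsOuterplanar) :
    ∃ c : G.Face → Fin 5, G.IsNonrepetitive c := by
  obtain ⟨O, hO, -, hpos⟩ := hG
  exact theorem1_general G ⟨O, hO⟩ hpos
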